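/- For $n\ge 1$ let $B_n$ be the set of signed permutations $\sigma=\sigma_1\sigma_2\cdots\sigma_n$ of $[n]=\{1,\dots,n\}$, i.e. words with letters in $\{\pm1,\dots,\pm n\}$ such that $|\sigma_1|\cdots|\sigma_n|$ is a permutation of $[n]$. Let $D_n^B$ be the set of those $\sigma\in B_n$ with $\sigma_i\ne i$ for all $i\in[n]$, and let $\mathrm{exc}_B(\sigma)$ be the number of $i\in[n]$ such that $\sigma_i=-i$ or $\sigma_{|\sigma_i|}>\sigma_i$. Put $$d_n^B(q)=\sum_{\sigma\in D_n^B}q^{\mathrm{exc}_B(\sigma)}\quad(n\ge1),\qquad d_0^B(q)=1 .$$ Then, as formal power series in $t$ over the field $\mathbb{Q}(q)$ of rational functions in the indeterminate $q$ (in which both denominators below are invertible), $$\sum_{n\ge0}d_n^B(q)\frac{t^n}{n!}=\frac{(1-q)e^{tq}}{e^{2tq}-q\,e^{2t}}=\frac{e^{tq}}{1-\sum_{n\ge2}2^n\,(q+q^2+\cdots+q^{n-1})\,\frac{t^n}{n!}} .$$ -/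

import Mathlib

/-- A signed permutation of `[n]`, i.e. an element of the hyperoctahedral group `B_n`: a
permutation of `[n]` (`Fin n` stands for `[n]`, with `i : Fin n` standing for `i + 1`) together
with a sign attached to each entry of its word. -/
abbrev SignedPerm (n : ℕ) : Type := Equiv.Perm (Fin n) × (Fin n → ℤˣ)

namespace SignedPerm

/-- The position `i : Fin n` as an element of `[n] = {1, …, n}`. -/
def pos {n : ℕ} (i : Fin n) : ℤ := (i : ℤ) + 1

/-- The `i`-th letter `σ_i` of the word `σ_1 σ_2 ⋯ σ_n`, an element of `{±1, …, ±n}`. -/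
def letter {n : ℕ} (σ : SignedPerm n) (i : Fin n) : ℤ := (σ.2 i : ℤ) * pos (σ.1 i)

/-- The position `|σ_i|` is the one denoted by `σ.1 i`. -/
theorem pos_fst_eq_abs_letter {n : ℕ} (σ : SignedPerm n) (i : Fin n) :
    pos (σ.1 i) = |σ.letter i| := by
  have h : (0 : ℤ) ≤ pos (σ.1 i) := by unfold pos; positivity
  rcases Int.units_eq_one_or (σ.2 i) with hs | hs <;> simp [letter, hs, abs_of_nonneg h]

/-- `σ` is a derangement of type `B`: `σ_i ≠ i` for all `i`. -/
def IsDerangement {n : ℕ} (σ : SignedPerm n) : Prop := ∀ i : Fin n, σ.letter i ≠ pos i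

/-- `i` is a type `B` excedance of `σ`: `σ_i = -i` or `σ_{|σ_i|} > σ_i`. -/
def IsExcedance {n : ℕ} (σ : SignedPerm n) (i : Fin n) : Prop :=
  σ.letter i = -pos i ∨ σ.letter (σ.1 i) > σ.letter i

instance {n : ℕ} (σ : SignedPerm n) : Decidable σ.IsDerangement :=
  inferInstanceAs (Decidable (∀ i : Fin n, σ.letter i ≠ pos i))

instance {n : ℕ} (σ : SignedPerm n) (i : Fin n) : Decidable (σ.IsExcedance i) :=
  inferInstanceAs (Decidable (σ.letter i = -pos i ∨ σ.letter (σ.1 i) > σ.letter i))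

/-- The number `exc_B(σ)` of type `B` excedances of `σ`. -/
def excB {n : ℕ} (σ : SignedPerm n) : ℕ :=
  (Finset.univ.filter fun i : Fin n => σ.IsExcedance i).card

end SignedPerm

/-- The type `B` derangement polynomial `d_n^B(q) = ∑_{σ ∈ D_n^B} q^{exc_B(σ)}`, with `q` the
polynomial variable. For `n = 0` the sum has one term, so that the polynomial is `1`. -/
noncomputable def derangementPolyB (n : ℕ) : Polynomial ℚ :=
  ∑ σ ∈ Finset.univ.filter fun σ : SignedPerm n => σ.IsDerangement,
    (Polynomial.X : Polynomial ℚ) ^ σ.excB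

theorem derangementPolyB_zero : derangementPolyB 0 = 1 := by
  simp [derangementPolyB, SignedPerm.IsDerangement, SignedPerm.excB, Finset.filter_true_of_mem]

/-- The exponential generating function `∑_{n ≥ 0} d_n^B(q) t^n / n!`, a formal power series in `t`
over the field `ℚ(q)` of rational functions. -/
noncomputable def derangementEGF : PowerSeries (RatFunc ℚ) :=
  PowerSeries.mk fun n =>
    algebraMap (Polynomial ℚ) (RatFunc ℚ) (derangementPolyB n) / (n.factorial : RatFunc ℚ)

/-- The formal power series `e^{a t}` in `t`. -/
noncomputable def expMulT (a : RatFunc ℚ) : PowerSeries (RatFunc ℚ) :=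
  PowerSeries.rescale a (PowerSeries.exp (RatFunc ℚ))

/-- The formal power series `∑_{n ≥ 2} 2^n (q + q^2 + ⋯ + q^{n-1}) t^n / n!` in `t`. -/
noncomputable def primeCycleEGF : PowerSeries (RatFunc ℚ) :=
  PowerSeries.mk fun n =>
    if 2 ≤ n then
      2 ^ n * (∑ i ∈ Finset.Icc 1 (n - 1), RatFunc.X ^ i) / (n.factorial : RatFunc ℚ)
    else 0

/-! Write a signed permutation as a permutation `π` with a sign on each value. It is a type `B`
derangement iff every fixed point of `π` is negative; each fixed point is then an excedance. On the
set `s` of moved points the signs are free, and the other excedances are those of a derangement of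
`s` for the signed labels. Since only the relative order of labels matters, each of the `2 ^ k` sign
choices on `k` moved points yields the type `A` polynomial
(`derangementPolyB_eq_sum_derangementPolyA`). So the series is `D(2t) e^{qt}`, with `D` the type `A`
derangement series.

Splitting off fixed points gives `A = D e^t` for the Eulerian series `A`. The insertion recurrence
yields `A_n(q) = (1-q)^(n+1) ∑ (m+1)^n q^m` (`coe_eulerianPoly`), whence `A (q - e^{(q-1)t}) = q -
1`. This determines `D`. -/

/-! ### Excedances of permutations and derangements -/

section Excedances

open Equiv Finset

/-- The number of excedances of a permutation of `α` with respect to the labelling `v`. -/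
def excedanceCount {α β : Type*} [Fintype α] [LinearOrder β] (v : α → β) (π : Perm α) : ℕ :=
  (univ.filter fun a => v a < v (π a)).card

/-- The Eulerian polynomial `∑_{π ∈ S_n} q^{exc π}`. -/
noncomputable def eulerianPoly (n : ℕ) : Polynomial ℚ :=
  ∑ π : Perm (Fin n), Polynomial.X ^ excedanceCount id π

/-- The derangement polynomial `∑_{π ∈ D_n} q^{exc π}` of type `A`. -/
noncomputable def derangementPolyA (n : ℕ) : Polynomial ℚ :=
  ∑ π : derangements (Fin n), Polynomial.X ^ excedanceCount id (π : Perm (Fin n))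

theorem excedanceCount_permCongr {α α' β : Type*} [Fintype α] [Fintype α'] [LinearOrder β]
    (v : α' → β) (e : α ≃ α') (π : Perm α) :
    excedanceCount v (e.permCongr π) = excedanceCount (v ∘ e) π := by
  unfold excedanceCount
  refine (card_equiv e fun a => ?_).symm
  rw [mem_filter, mem_filter]
  simp

theorem excedanceCount_comp_strictMono {α β γ : Type*} [Fintype α] [LinearOrder β]
    [LinearOrder γ] (v : α → β) {f : β → γ} (hf : StrictMono f) (π : Perm α) :
    excedanceCount (f ∘ v) π = excedanceCount v π := by
  simp [excedanceCount, hf.lt_iff_lt]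

/-- Sorting `α` by `v` carries its derangements to those of `Fin`; excedances see only the order of
the labels. -/
theorem sum_derangements_pow_excedanceCount {α β : Type*} [Fintype α] [DecidableEq α]
    [LinearOrder β] (v : α → β) (hv : Function.Injective v) :
    ∑ π : derangements α, (Polynomial.X : Polynomial ℚ) ^ excedanceCount v (π : Perm α) =
      derangementPolyA (Fintype.card α) := by
  obtain ⟨e, he⟩ : ∃ e : Fin (Fintype.card α) ≃ α, StrictMono (v ∘ e) := by
    let : LinearOrder α := LinearOrder.lift' v hv
    exact ⟨(Fintype.orderIsoFinOfCardEq α rfl).toEquiv,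
      fun a b hab => (Fintype.orderIsoFinOfCardEq α rfl).strictMono hab⟩
  unfold derangementPolyA
  refine (Fintype.sum_equiv e.derangementsCongr _ _ fun π => ?_).symm
  change _ = Polynomial.X ^ excedanceCount v (e.permCongr π)
  rw [excedanceCount_permCongr, ← excedanceCount_comp_strictMono id he]
  rfl

/-- Summing over permutations amounts to summing over the derangements of the complement of each
possible set of fixed points. -/
theorem sum_perm_eq_sum_derangements {α M : Type*} [Fintype α] [DecidableEq α] [AddCommMonoid M]
    (G : Perm α → M) :
    ∑ π, G π = ∑ s : Finset α, ∑ δ : derangements {a // a ∈ s},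
      G (Perm.ofSubtype (δ : Perm {a // a ∈ s})) := by
  rw [← sum_fiberwise (univ : Finset (Perm α)) (fun π => univ.filter fun a => π a ≠ a)]
  refine sum_congr rfl fun s _ => ?_
  rw [sum_subtype (p := fun f : Perm α => ∀ a, ¬ a ∈ s ↔ a ∈ Function.fixedPoints f)]
  · refine (Fintype.sum_equiv (derangements.subtypeEquiv (· ∈ s)) _ _ fun δ => ?_).symm
    rfl
  · intro π
    simp only [mem_filter, mem_univ, true_and, Finset.ext_iff, Function.mem_fixedPoints,
      Function.IsFixedPt]
    exact forall_congr' fun a => by tauto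

theorem card_filter_ofSubtype {α : Type*} [Fintype α] [DecidableEq α] (s : Finset α)
    (δ : Perm {a // a ∈ s}) (P Q : α → α → Prop) [DecidableRel P] [DecidableRel Q]
    (hP : ∀ a, a ∉ s → ¬ P a a) (h : ∀ a : {a // a ∈ s}, P a (δ a) ↔ Q a (δ a)) :
    (univ.filter fun a => P a (Perm.ofSubtype δ a)).card =
      (univ.filter fun a : {a // a ∈ s} => Q a (δ a)).card := by
  symm
  refine card_bij (fun a _ => a.1) ?_ (fun a _ b _ hab => Subtype.ext hab) ?_
  · intro a ha
    simp only [mem_filter, mem_univ, true_and] at ha ⊢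
    rw [Perm.ofSubtype_apply_coe]
    exact (h a).2 ha
  · intro a ha
    simp only [mem_filter, mem_univ, true_and] at ha
    by_cases hs : a ∈ s
    · refine ⟨⟨a, hs⟩, ?_, rfl⟩
      rw [Perm.ofSubtype_apply_of_mem δ hs] at ha
      simpa using (h ⟨a, hs⟩).1 ha
    · rw [Perm.ofSubtype_apply_of_not_mem δ hs] at ha
      exact absurd ha (hP a hs)

theorem excedanceCount_ofSubtype {α β : Type*} [Fintype α] [DecidableEq α] [LinearOrder β]
    (v : α → β) (s : Finset α) (δ : Perm {a // a ∈ s}) :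
    excedanceCount v (Perm.ofSubtype δ) = excedanceCount (fun a : {a // a ∈ s} => v a) δ :=
  card_filter_ofSubtype s δ (fun a b => v a < v b) (fun a b => v a < v b)
    (fun _ _ => lt_irrefl _) fun _ => Iff.rfl

theorem sum_finset_apply_card {α : Type*} [Fintype α] (f : ℕ → Polynomial ℚ) :
    ∑ s : Finset α, f s.card =
      ∑ k ∈ range (Fintype.card α + 1), ((Fintype.card α).choose k : Polynomial ℚ) * f k := by
  rw [← powerset_univ, sum_powerset_apply_card, card_univ]
  simp only [nsmul_eq_mul]

theorem eulerianPoly_eq_sum_derangementPolyA (n : ℕ) :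
    eulerianPoly n =
      ∑ k ∈ range (n + 1), (n.choose k : Polynomial ℚ) * derangementPolyA k := by
  rw [eulerianPoly, sum_perm_eq_sum_derangements]
  simp only [excedanceCount_ofSubtype]
  calc
    _ = ∑ s : Finset (Fin n), derangementPolyA s.card := by
      refine sum_congr rfl fun s _ => ?_
      rw [sum_derangements_pow_excedanceCount (fun a : {a // a ∈ s} => id a.1)
        Subtype.val_injective, Fintype.card_coe]
    _ = _ := by simpa using sum_finset_apply_card (α := Fin n) derangementPolyA

/-! ### Eulerian polynomials: recurrence and power series -/

theorem excedanceCount_decomposeFin_symm_zero {n : ℕ} (e : Perm (Fin n)) :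
    excedanceCount id (Perm.decomposeFin.symm (0, e)) = excedanceCount id e := by
  simp only [excedanceCount, card_filter, Fin.sum_univ_succ, Perm.decomposeFin_symm_apply_zero,
    Perm.decomposeFin_symm_apply_succ]
  simp

/-- The new least point `0` is inserted in a cycle between `i` and `e i`: `0` becomes an excedance,
while `i`, now sent to `0`, is not one. -/
theorem excedanceCount_decomposeFin_symm_succ {n : ℕ} (e : Perm (Fin n)) (i : Fin n) :
    excedanceCount id (Perm.decomposeFin.symm ((e i).succ, e)) =
      if i < e i then excedanceCount id e else excedanceCount id e + 1 := by
  have h : ∀ k, (k.succ < swap 0 (e i).succ (e k).succ ↔ k < e k ∧ k ≠ i) := by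
    intro k
    by_cases hk : k = i
    · simp [hk]
    · rw [swap_apply_of_ne_of_ne (Fin.succ_ne_zero _) (by simpa using hk)]
      simp [hk]
  have h' : excedanceCount id (Perm.decomposeFin.symm ((e i).succ, e)) =
      ((univ.filter fun k => k < e k).erase i).card + 1 := by
    rw [excedanceCount, card_filter, Fin.sum_univ_succ]
    simp only [Perm.decomposeFin_symm_apply_zero, Perm.decomposeFin_symm_apply_succ, id, h]
    rw [← card_filter, if_pos (Fin.succ_pos _), add_comm]
    congr 2
    ext k
    simp [and_comm]
  rw [h', excedanceCount]
  split_ifs with hi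
  · rw [card_erase_add_one (by simpa using hi)]
    rfl
  · rw [erase_eq_of_notMem (by simpa using hi)]
    rfl

/-- With `x` excedances in `e`, the insertions contribute `(1 + x) q^x + (n - x) q^(x+1)`; the terms
linear in `x` form the derivative. -/
theorem eulerianPoly_succ (n : ℕ) :
    eulerianPoly (n + 1) = (1 + (n : Polynomial ℚ) * Polynomial.X) * eulerianPoly n +
      Polynomial.X * (1 - Polynomial.X) * Polynomial.derivative (eulerianPoly n) := by
  have key : ∀ e : Perm (Fin n),
      ∑ p : Fin (n + 1),
        (Polynomial.X : Polynomial ℚ) ^ excedanceCount id (Perm.decomposeFin.symm (p, e)) =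
      (1 + (n : Polynomial ℚ) * Polynomial.X) * Polynomial.X ^ excedanceCount id e +
        Polynomial.X * (1 - Polynomial.X) *
          Polynomial.derivative (Polynomial.X ^ excedanceCount id e) := by
    intro e
    rw [Fin.sum_univ_succ, excedanceCount_decomposeFin_symm_zero,
      ← Equiv.sum_comp e]
    have hcard : ((univ.filter fun i => ¬ i < e i).card : Polynomial ℚ) =
        n - excedanceCount id e := by
      have := card_filter_add_card_filter_not (s := (univ : Finset (Fin n))) (fun i => i < e i)
      rw [card_univ, Fintype.card_fin] at this
      rw [eq_sub_iff_add_eq, add_comm]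
      exact_mod_cast this
    simp only [excedanceCount_decomposeFin_symm_succ, apply_ite (HPow.hPow Polynomial.X)]
    rw [sum_ite, sum_const, sum_const, nsmul_eq_mul, nsmul_eq_mul, hcard,
      Polynomial.derivative_X_pow]
    change _ + (((excedanceCount id e : ℕ) : Polynomial ℚ) * _ + _) = _
    rcases excedanceCount id e with _ | k
    · simp
    · simp only [Nat.add_sub_cancel, map_natCast]
      ring
  rw [eulerianPoly, ← Equiv.sum_comp Perm.decomposeFin.symm, Fintype.sum_prod_type_right]
  simp only [key, eulerianPoly, sum_add_distrib, mul_sum, Polynomial.derivative_sum]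

theorem eulerianPoly_zero : eulerianPoly 0 = 1 := by
  simp [eulerianPoly, excedanceCount]

/-- The power series `∑_{m ≥ 0} (m + 1)^n q^m`. -/
def succPowSeries (n : ℕ) : PowerSeries ℚ := PowerSeries.mk fun m => ((m : ℚ) + 1) ^ n

theorem succPowSeries_succ (n : ℕ) :
    succPowSeries (n + 1) = succPowSeries n +
      PowerSeries.X * PowerSeries.derivative ℚ (succPowSeries n) := by
  ext m
  rcases m with _ | m
  · simp [succPowSeries]
  · rw [map_add, PowerSeries.coeff_succ_X_mul, PowerSeries.coeff_derivative]
    simp only [succPowSeries, PowerSeries.coeff_mk]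
    push_cast
    ring

theorem one_sub_X_mul_succPowSeries_zero :
    (1 - PowerSeries.X) * succPowSeries 0 = 1 := by
  have h := PowerSeries.mk_one_mul_one_sub_eq_one ℚ
  have h' : succPowSeries 0 = PowerSeries.mk 1 := by
    ext m
    simp [succPowSeries]
  rw [mul_comm, h', h]

theorem coe_natCast_polynomial (m : ℕ) : ((m : Polynomial ℚ) : PowerSeries ℚ) = m :=
  map_natCast (Polynomial.coeToPowerSeries.ringHom (R := ℚ)) m

theorem coe_eulerianPoly (n : ℕ) :
    (eulerianPoly n : PowerSeries ℚ) = (1 - PowerSeries.X) ^ (n + 1) * succPowSeries n := by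
  induction n with
  | zero => simp [eulerianPoly_zero, one_sub_X_mul_succPowSeries_zero]
  | succ n ih =>
    have hd : ((Polynomial.derivative (eulerianPoly n) : Polynomial ℚ) : PowerSeries ℚ) =
        (1 - PowerSeries.X) ^ (n + 1) * PowerSeries.derivative ℚ (succPowSeries n) -
          ((n : PowerSeries ℚ) + 1) * (1 - PowerSeries.X) ^ n * succPowSeries n := by
      rw [← PowerSeries.derivative_coe, ih, Derivation.leibniz, Derivation.leibniz_pow]
      simp [PowerSeries.derivative_X]
      ring
    rw [eulerianPoly_succ, succPowSeries_succ]
    push_cast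
    rw [coe_natCast_polynomial, hd, ih]
    ring

/-- Coefficientwise this is the binomial expansion of `((m + 1) - 1)^n = m^n`; the extra term is
`0^0 = 1`. -/
theorem sum_choose_succPowSeries (n : ℕ) :
    ∑ k ∈ range (n + 1), (n.choose k : PowerSeries ℚ) * (-1) ^ (n - k) * succPowSeries k =
      PowerSeries.X * succPowSeries n + if n = 0 then 1 else 0 := by
  ext m
  have h : ∀ k, PowerSeries.coeff m
      ((n.choose k : PowerSeries ℚ) * (-1) ^ (n - k) * succPowSeries k) =
        ((m : ℚ) + 1) ^ k * (-1) ^ (n - k) * n.choose k := by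
    intro k
    have hc : (n.choose k : PowerSeries ℚ) * (-1) ^ (n - k) =
        PowerSeries.C ((n.choose k : ℚ) * (-1) ^ (n - k)) := by simp
    rw [hc, PowerSeries.coeff_C_mul, succPowSeries, PowerSeries.coeff_mk]
    ring
  rw [map_sum, sum_congr rfl fun k _ => h k, ← add_pow, map_add]
  rcases m with _ | m
  · rcases n with _ | n <;> simp
  · rw [PowerSeries.coeff_succ_X_mul]
    rcases n with _ | n <;> simp [succPowSeries, PowerSeries.coeff_one]

/-- In `ℚ⟦q⟧`, writing `q - 1 = -(1 - q)` makes `(1 - q)^(n+1)` a common factor of the sum. -/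
theorem eulerianPoly_convolution (n : ℕ) :
    Polynomial.X * eulerianPoly n -
      ∑ k ∈ range (n + 1),
        (n.choose k : Polynomial ℚ) * eulerianPoly k * (Polynomial.X - 1) ^ (n - k) =
      if n = 0 then Polynomial.X - 1 else 0 := by
  apply Polynomial.coe_injective ℚ
  have h : ((∑ k ∈ range (n + 1), (n.choose k : Polynomial ℚ) * eulerianPoly k *
      (Polynomial.X - 1) ^ (n - k) : Polynomial ℚ) : PowerSeries ℚ) =
      (1 - PowerSeries.X) ^ (n + 1) * (PowerSeries.X * succPowSeries n + if n = 0 then 1 else 0) := by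
    rw [← sum_choose_succPowSeries, mul_sum, ← Polynomial.coeToPowerSeries.ringHom_apply, map_sum]
    refine sum_congr rfl fun k hk => ?_
    obtain ⟨d, rfl⟩ := Nat.exists_eq_add_of_le (Nat.lt_succ_iff.1 (mem_range.1 hk))
    rw [Polynomial.coeToPowerSeries.ringHom_apply]
    push_cast
    rw [coe_natCast_polynomial, coe_eulerianPoly, Nat.add_sub_cancel_left,
      show (PowerSeries.X - 1 : PowerSeries ℚ) = (-1) * (1 - PowerSeries.X) by ring, mul_pow]
    ring
  rw [Polynomial.coe_sub, h, Polynomial.coe_mul, coe_eulerianPoly]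
  rcases n with _ | n
  · simp
    ring
  · simp
    ring

end Excedances

/-! ### Reduction from type `B` to type `A` -/

section SignedPermutations

open Equiv Finset

namespace SignedPerm

/-- The label `ε_j j` of the value `j`, where `ε_j` is the sign of the letter `±j`. -/
def signedLabel {n : ℕ} (ε : Fin n → ℤˣ) (j : Fin n) : ℤ := (ε j : ℤ) * pos j

theorem pos_pos {n : ℕ} (j : Fin n) : 0 < pos j := by unfold pos; positivity

theorem abs_signedLabel {n : ℕ} (ε : Fin n → ℤˣ) (j : Fin n) : |signedLabel ε j| = pos j := by
  have := (pos_pos j).le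
  rcases Int.units_eq_one_or (ε j) with h | h <;> simp [signedLabel, h, abs_of_nonneg this]

theorem pos_injective {n : ℕ} : Function.Injective (pos : Fin n → ℤ) := by
  intro i j h
  simpa [pos, Fin.ext_iff] using h

theorem signedLabel_injective {n : ℕ} (ε : Fin n → ℤˣ) : Function.Injective (signedLabel ε) := by
  intro i j h
  apply pos_injective
  rw [← abs_signedLabel ε, h, abs_signedLabel]

theorem signedLabel_eq_pos_iff {n : ℕ} (ε : Fin n → ℤˣ) (i j : Fin n) :
    signedLabel ε j = pos i ↔ j = i ∧ ε j = 1 := by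
  constructor
  · intro h
    have hji : j = i := pos_injective (by rw [← abs_signedLabel ε, h, abs_of_pos (pos_pos i)])
    refine ⟨hji, ?_⟩
    subst hji
    rcases Int.units_eq_one_or (ε j) with hs | hs
    · exact hs
    · have := pos_pos j
      simp [signedLabel, hs] at h
      omega
  · rintro ⟨rfl, h⟩
    simp [signedLabel, h]

theorem signedLabel_eq_neg_pos_iff {n : ℕ} (ε : Fin n → ℤˣ) (i j : Fin n) :
    signedLabel ε j = -pos i ↔ j = i ∧ ε j = -1 := by
  have h := signedLabel_eq_pos_iff (-ε) i j
  simp only [signedLabel, Pi.neg_apply, Units.val_neg, neg_mul] at h ⊢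
  rw [← neg_eq_iff_eq_neg, h, neg_eq_iff_eq_neg]

/-- Signed permutations as a permutation together with a sign attached to each value. -/
def signValueEquiv (n : ℕ) : Perm (Fin n) × (Fin n → ℤˣ) ≃ SignedPerm n where
  toFun x := (x.1, x.2 ∘ x.1)
  invFun x := (x.1, x.2 ∘ x.1.symm)
  left_inv x := by ext <;> simp
  right_inv x := by ext <;> simp

theorem isDerangement_signValueEquiv {n : ℕ} (π : Perm (Fin n)) (ε : Fin n → ℤˣ) :
    (signValueEquiv n (π, ε)).IsDerangement ↔ ∀ j, π j = j → ε j = -1 := by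
  refine forall_congr' fun i => ?_
  change signedLabel ε (π i) ≠ pos i ↔ _
  rw [Ne, signedLabel_eq_pos_iff, not_and]
  refine forall_congr' fun h => ?_
  rw [h]
  rcases Int.units_eq_one_or (ε i) with hs | hs <;> simp [hs]

/-- Reindexing by the value `j = π i` turns comparison of letters into comparison of the labels of
`j` and `π j`. -/
theorem excB_signValueEquiv {n : ℕ} (π : Perm (Fin n)) (ε : Fin n → ℤˣ) :
    (signValueEquiv n (π, ε)).excB =
      (univ.filter fun j => (π j = j ∧ ε j = -1) ∨ signedLabel ε j < signedLabel ε (π j)).card := by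
  refine card_equiv π fun i => ?_
  simp only [mem_filter, mem_univ, true_and]
  change signedLabel ε (π i) = -pos i ∨ signedLabel ε (π (π i)) > signedLabel ε (π i) ↔ _
  rw [signedLabel_eq_neg_pos_iff, gt_iff_lt, EmbeddingLike.apply_eq_iff_eq]

theorem isDerangement_ofSubtype {n : ℕ} (s : Finset (Fin n)) (δ : derangements {a // a ∈ s})
    (ε : Fin n → ℤˣ) :
    (signValueEquiv n (Perm.ofSubtype (δ : Perm {a // a ∈ s}), ε)).IsDerangement ↔
      ∀ j ∉ s, ε j = -1 := by
  rw [isDerangement_signValueEquiv]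
  refine forall_congr' fun j => imp_congr_left ?_
  by_cases hj : j ∈ s
  · rw [Perm.ofSubtype_apply_of_mem _ hj]
    simp only [hj, not_true, iff_false]
    exact fun h => δ.2 ⟨j, hj⟩ (Subtype.ext h)
  · simp [hj, Perm.ofSubtype_apply_of_not_mem]

theorem excB_ofSubtype {n : ℕ} (s : Finset (Fin n)) (δ : derangements {a // a ∈ s})
    (ε : Fin n → ℤˣ) (hε : ∀ j ∉ s, ε j = -1) :
    (signValueEquiv n (Perm.ofSubtype (δ : Perm {a // a ∈ s}), ε)).excB =
      (n - s.card) +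
        excedanceCount (fun a : {a // a ∈ s} => signedLabel ε a) (δ : Perm {a // a ∈ s}) := by
  rw [excB_signValueEquiv, ← excedanceCount_ofSubtype, excedanceCount, filter_or,
    card_union_of_disjoint]
  · congr 1
    have : (univ.filter fun j => Perm.ofSubtype (δ : Perm {a // a ∈ s}) j = j ∧ ε j = -1) = sᶜ := by
      ext j
      simp only [mem_filter, mem_univ, true_and, mem_compl]
      by_cases hj : j ∈ s
      · rw [Perm.ofSubtype_apply_of_mem _ hj]
        simp only [hj, not_true, iff_false]
        exact fun h => δ.2 ⟨j, hj⟩ (Subtype.ext h.1)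
      · simp [hj, Perm.ofSubtype_apply_of_not_mem, hε j hj]
    rw [this, card_compl, Fintype.card_fin]
  · rw [disjoint_filter]
    rintro j - ⟨h, -⟩
    rw [h]
    exact lt_irrefl _

theorem card_filter_eq_neg_one_off {n : ℕ} (s : Finset (Fin n)) :
    (univ.filter fun ε : Fin n → ℤˣ => ∀ j ∉ s, ε j = -1).card = 2 ^ s.card := by
  have : (univ.filter fun ε : Fin n → ℤˣ => ∀ j ∉ s, ε j = -1) =
      Fintype.piFinset fun j => if j ∈ s then univ else {-1} := by
    ext ε
    simp only [mem_filter, mem_univ, true_and, Fintype.mem_piFinset]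
    refine forall_congr' fun j => ?_
    by_cases hj : j ∈ s <;> simp [hj, Int.units_eq_one_or]
  rw [this, Fintype.card_piFinset]
  simp [apply_ite Finset.card]

end SignedPerm

open SignedPerm in
theorem derangementPolyB_eq_sum_derangementPolyA (n : ℕ) :
    derangementPolyB n = ∑ k ∈ range (n + 1),
      (n.choose k : Polynomial ℚ) * (2 ^ k * derangementPolyA k) * Polynomial.X ^ (n - k) := by
  have key : ∀ s : Finset (Fin n), ∀ ε : Fin n → ℤˣ,
      (∑ δ : derangements {a // a ∈ s},
        if (signValueEquiv n (Perm.ofSubtype (δ : Perm {a // a ∈ s}), ε)).IsDerangement then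
          (Polynomial.X : Polynomial ℚ) ^
            (signValueEquiv n (Perm.ofSubtype (δ : Perm {a // a ∈ s}), ε)).excB
        else 0) =
      if ∀ j ∉ s, ε j = -1 then Polynomial.X ^ (n - s.card) * derangementPolyA s.card else 0 := by
    intro s ε
    simp only [isDerangement_ofSubtype]
    split_ifs with h
    · rw [sum_congr rfl fun δ _ => by rw [excB_ofSubtype s δ ε h, pow_add], ← mul_sum,
        sum_derangements_pow_excedanceCount (fun a : {a // a ∈ s} => signedLabel ε a)
          ((signedLabel_injective ε).comp Subtype.val_injective), Fintype.card_coe]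
    · simp
  rw [derangementPolyB, sum_filter, ← Equiv.sum_comp (signValueEquiv n),
    Fintype.sum_prod_type_right]
  simp only [sum_perm_eq_sum_derangements, key]
  rw [sum_comm]
  simp only [← sum_filter, sum_const, card_filter_eq_neg_one_off, nsmul_eq_mul]
  have h := sum_finset_apply_card (α := Fin n) fun k =>
    2 ^ k * derangementPolyA k * Polynomial.X ^ (n - k)
  rw [Fintype.card_fin] at h
  push_cast
  simp only [mul_assoc] at h ⊢
  rw [← h]
  refine sum_congr rfl fun s _ => by ring

end SignedPermutations

/-! ### Exponential generating functions -/

section GeneratingFunctions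

open Finset PowerSeries

/-- The exponential generating function of a sequence of polynomials in `q`. -/
noncomputable def egf (a : ℕ → Polynomial ℚ) : PowerSeries (RatFunc ℚ) :=
  PowerSeries.mk fun n =>
    algebraMap (Polynomial ℚ) (RatFunc ℚ) (a n) / (n.factorial : RatFunc ℚ)

theorem egf_mul (a b : ℕ → Polynomial ℚ) :
    egf a * egf b = egf fun n =>
      ∑ k ∈ range (n + 1), (n.choose k : Polynomial ℚ) * a k * b (n - k) := by
  ext n
  rw [coeff_mul, Nat.sum_antidiagonal_eq_sum_range_succ_mk]
  simp only [egf, coeff_mk, map_sum, sum_div]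
  refine sum_congr rfl fun k hk => ?_
  have hk : k ≤ n := Nat.lt_succ_iff.1 (mem_range.1 hk)
  have h := Nat.choose_mul_factorial_mul_factorial hk
  have h : ((n.choose k : ℕ) : RatFunc ℚ) * k.factorial * (n - k).factorial = n.factorial := by
    exact_mod_cast h
  have h₁ : (k.factorial : RatFunc ℚ) ≠ 0 := by exact_mod_cast k.factorial_ne_zero
  have h₂ : ((n - k).factorial : RatFunc ℚ) ≠ 0 := by exact_mod_cast (n - k).factorial_ne_zero
  have h₃ : (n.factorial : RatFunc ℚ) ≠ 0 := by exact_mod_cast n.factorial_ne_zero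
  simp only [map_mul, map_natCast]
  field_simp
  rw [← h]
  ring

theorem expMulT_algebraMap (p : Polynomial ℚ) :
    expMulT (algebraMap _ _ p) = egf fun n => p ^ n := by
  ext n
  simp [expMulT, egf, coeff_rescale, coeff_exp, div_eq_mul_inv]

theorem egf_sub (a b : ℕ → Polynomial ℚ) : egf a - egf b = egf fun n => a n - b n := by
  ext n
  simp [egf, sub_div]

theorem C_mul_egf (p : Polynomial ℚ) (a : ℕ → Polynomial ℚ) :
    C (algebraMap _ _ p) * egf a = egf fun n => p * a n := by
  ext n
  simp [egf, mul_div_assoc]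

theorem expMulT_mul_expMulT (a b : RatFunc ℚ) : expMulT a * expMulT b = expMulT (a + b) :=
  exp_mul_exp_eq_exp_add a b

theorem rescale_expMulT (a b : RatFunc ℚ) : rescale b (expMulT a) = expMulT (b * a) := by
  rw [expMulT, rescale_rescale, mul_comm, expMulT]

theorem constantCoeff_expMulT (a : RatFunc ℚ) : constantCoeff (expMulT a) = 1 := by
  rw [← coeff_zero_eq_constantCoeff_apply, expMulT, coeff_rescale]
  simp

theorem egf_eulerianPoly :
    egf eulerianPoly * (C RatFunc.X - expMulT (RatFunc.X - 1)) = C (RatFunc.X - 1) := by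
  have hX : (RatFunc.X - 1 : RatFunc ℚ) =
      algebraMap (Polynomial ℚ) (RatFunc ℚ) (Polynomial.X - 1) := by simp
  rw [mul_sub, hX, expMulT_algebraMap, egf_mul, mul_comm, ← RatFunc.algebraMap_X, C_mul_egf,
    egf_sub]
  simp only [eulerianPoly_convolution]
  ext n
  rw [coeff_C]
  rcases n with _ | n <;> simp [egf]

theorem egf_eulerianPoly_eq : egf eulerianPoly = egf derangementPolyA * expMulT 1 := by
  have := expMulT_algebraMap 1
  rw [map_one] at this
  rw [this, egf_mul]
  congr 1
  funext n
  simp [eulerianPoly_eq_sum_derangementPolyA]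

theorem egf_derangementPolyA :
    egf derangementPolyA * (expMulT RatFunc.X - C RatFunc.X * expMulT 1) = 1 - C RatFunc.X := by
  have h := egf_eulerianPoly
  have h' : expMulT RatFunc.X = expMulT 1 * expMulT (RatFunc.X - 1) := by
    rw [expMulT_mul_expMulT, add_sub_cancel]
  rw [egf_eulerianPoly_eq, map_sub, map_one] at h
  rw [h']
  linear_combination -h

theorem derangementEGF_eq_rescale :
    derangementEGF = rescale 2 (egf derangementPolyA) * expMulT RatFunc.X := by
  have h : rescale 2 (egf derangementPolyA) = egf fun k => 2 ^ k * derangementPolyA k := by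
    ext n
    simp only [egf, coeff_rescale, coeff_mk, map_mul, map_pow, map_ofNat, mul_div_assoc]
  rw [h, ← RatFunc.algebraMap_X, expMulT_algebraMap, egf_mul]
  simp only [← derangementPolyB_eq_sum_derangementPolyA]
  rfl

theorem derangementEGF_mul :
    derangementEGF * (expMulT (2 * RatFunc.X) - C RatFunc.X * expMulT 2) =
      (1 - C RatFunc.X) * expMulT RatFunc.X := by
  have h := congrArg (rescale (2 : RatFunc ℚ)) egf_derangementPolyA
  have hC : rescale (2 : RatFunc ℚ) (C RatFunc.X) = C RatFunc.X := by
    ext n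
    rcases n with _ | n <;> simp [coeff_rescale, coeff_C]
  simp only [map_mul, map_sub, map_one, hC, rescale_expMulT, mul_one] at h
  rw [derangementEGF_eq_rescale]
  linear_combination expMulT RatFunc.X * h

theorem one_sub_X_ne_zero : (1 - RatFunc.X : RatFunc ℚ) ≠ 0 := by
  intro h
  have h' : algebraMap (Polynomial ℚ) (RatFunc ℚ) (1 - Polynomial.X) = algebraMap _ _ 0 := by
    simpa using h
  have := congrArg (Polynomial.eval 0) (RatFunc.algebraMap_injective ℚ h')
  simp at this

theorem one_sub_X_mul_one_sub_primeCycleEGF :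
    (1 - C RatFunc.X) * (1 - primeCycleEGF) =
      expMulT (2 * RatFunc.X) - C RatFunc.X * expMulT 2 := by
  have hC : (1 - C RatFunc.X : PowerSeries (RatFunc ℚ)) = C (1 - RatFunc.X) := by simp
  rw [hC]
  ext n
  rw [coeff_C_mul]
  simp only [map_sub (coeff n), coeff_C_mul, expMulT, coeff_rescale, coeff_exp, primeCycleEGF,
    coeff_mk, coeff_one]
  -- In degree 1 the right side is `2q - 2q = 0`, so `primeCycleEGF` starts in degree 2; from there
  -- on `(1 - q)(q + ⋯ + q^(n-1)) = q - q^n`.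
  rcases n with _ | _ | n
  · simp
  · simp
    ring
  · have hg : (1 - RatFunc.X : RatFunc ℚ) * ∑ i ∈ Icc 1 (n + 2 - 1), RatFunc.X ^ i =
        RatFunc.X - RatFunc.X ^ (n + 2) := by
      have hI : Icc 1 (n + 2 - 1) = Ico 1 (n + 2) := by
        ext i
        simp only [mem_Icc, mem_Ico]
        omega
      have h := geom_sum_Ico_mul_neg (RatFunc.X : RatFunc ℚ) (show 1 ≤ n + 2 by omega)
      rw [hI, mul_comm, h, pow_one]
    rw [if_pos (by omega : 2 ≤ n + 1 + 1), if_neg (by omega : ¬ n + 1 + 1 = 0), zero_sub,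
      mul_neg, mul_div_assoc', mul_left_comm, hg]
    simp
    ring

end GeneratingFunctions

/-- As formal power series in `t` over `ℚ(q)`, both denominators being invertible there (`f⁻¹` is
the multiplicative inverse of `f` exactly when the constant coefficient of `f` is nonzero). -/
theorem mainTheorem2 :
    PowerSeries.constantCoeff
        (expMulT (2 * RatFunc.X) - PowerSeries.C RatFunc.X * expMulT 2) ≠ 0 ∧
    PowerSeries.constantCoeff (1 - primeCycleEGF) ≠ 0 ∧
    derangementEGF =
      (1 - PowerSeries.C RatFunc.X) * expMulT RatFunc.X *
        (expMulT (2 * RatFunc.X) - PowerSeries.C RatFunc.X * expMulT 2)⁻¹ ∧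
    derangementEGF = expMulT RatFunc.X * (1 - primeCycleEGF)⁻¹ := by
  have hX : (1 - RatFunc.X : RatFunc ℚ) ≠ 0 := one_sub_X_ne_zero
  have h₁ : PowerSeries.constantCoeff
      (expMulT (2 * RatFunc.X) - PowerSeries.C RatFunc.X * expMulT 2) ≠ 0 := by
    simpa [constantCoeff_expMulT] using hX
  have h₂ : PowerSeries.constantCoeff (1 - primeCycleEGF) ≠ 0 := by
    simp [primeCycleEGF]
  refine ⟨h₁, h₂, ?_, ?_⟩
  · rw [PowerSeries.eq_mul_inv_iff_mul_eq h₁, derangementEGF_mul]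
  · rw [PowerSeries.eq_mul_inv_iff_mul_eq h₂]
    have hC : (1 - PowerSeries.C RatFunc.X : PowerSeries (RatFunc ℚ)) ≠ 0 := by
      intro h
      apply hX
      simpa using congrArg PowerSeries.constantCoeff h
    apply mul_left_cancel₀ hC
    rw [← derangementEGF_mul, ← one_sub_X_mul_one_sub_primeCycleEGF]
    ring
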